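/- Let $E(1,1)=\mathbb R^3$ be the group of rigid motions of the Minkowski plane, with the frame $$X_1=\partial_{x_3},\quad X_2=\tfrac1{\sqrt2}\left(-e^{x_3}\partial_{x_1}+e^{-x_3}\partial_{x_2}\right),\quad X_3=-\tfrac1{\sqrt2}\left(e^{x_3}\partial_{x_1}+e^{-x_3}\partial_{x_2}\right)$$ and, for $L>0$, let $g_L=\langle\cdot,\cdot\rangle_L$ be the Riemannian metric for which $X_1,X_2,\widetilde X_3:=L^{-1/2}X_3$ are orthonormal, with Levi-Civita connection $\nabla^L$ and curvature $R^L(X,Y)Z=\nabla^L_X\nabla^L_YZ-\nabla^L_Y\nabla^L_XZ-\nabla^L_{[X,Y]}Z$. Let $u:\mathbb R^3\to\mathbb R$ be of class $C^2$ and $\Sigma_1=\{u=0\}$. Put $\nabla_Hf=X_1(f)X_1+X_2(f)X_2$; a point of $\Sigma_1$ is characteristic if $\nabla_Hu=0$ there. (Near a non-characteristic point $du\ne0$, so $\Sigma_1$ is a $C^2$ surface.) Write $p=X_1u$, $q=X_2u$, $r=\widetilde X_3u$, $l=|\nabla_Hu|=\sqrt{p^2+q^2}$, $l_L=\sqrt{p^2+q^2+r^2}$,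 and, where $l\neq0$, $$v_L=\tfrac{p}{l_L}X_1+\tfrac{q}{l_L}X_2+\tfrac{r}{l_L}\widetilde X_3,\quad e_1=\tfrac ql X_1-\tfrac pl X_2,\quad e_2=\tfrac{r}{l_L}\tfrac pl X_1+\tfrac{r}{l_L}\tfrac ql X_2-\tfrac{l}{l_L}\widetilde X_3,$$ so that $v_L$ is the $g_L$-unit normal and $e_1,e_2$ is a $g_L$-orthonormal tangent frame of $\Sigma_1$. The Riemannian Gaussian curvature of the $C^2$ surface $\Sigma_1$ in $(E(1,1),g_L)$ is $$\mathcal K^{\Sigma_1,L}(e_1,e_2)=-\langle R^L(e_1,e_2)e_1,e_2\rangle_L+\det\left(\langle\nabla^L_{e_i}v_L,e_j\rangle_L\right)_{i,j=1,2}.$$ Then at every non-characteristic point $x\in\Sigma_1$ the limit $\mathcal K^{\Sigma_1,\infty}(e_1,e_2):=\lim_{L\to+\infty}\mathcal K^{\Sigma_1,L}(e_1,e_2)$ exists, and $$\mathcal K^{\Sigma_1,\infty}(e_1,e_2)=-\left\langle e_1,\nabla_H\left(\frac{X_3u}{|\nabla_Hu|}\right)\right\rangle-\frac{(X_3u)^2}{l^2},$$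 where the inner product of horizontal vectors is the one for which $X_1,X_2$ are orthonormal. Moreover, if $u$ is of class $C^3$ near $x$, then for every $L>0$ one has at $x$ $$\mathcal K^{\Sigma_1,L}(e_1,e_2)=-\langle R^{\Sigma_1,L}(e_1,e_2)e_1,e_2\rangle_L,$$ where $R^{\Sigma_1,L}$ is the curvature of the induced connection $\nabla^{\Sigma_1,L}_VW=\pi\nabla^L_VW$, with $\pi$ the $g_L$-orthogonal projection to the tangent planes of the level surfaces of $u$; hence this intrinsic curvature has the same limit. -/

import Mathlib

open Filter Topology

noncomputable section

namespace E11

/-- The manifold underlying the group `E(1,1)` of rigid motions of the Minkowski plane, `ℝ³`.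
The coordinates `x₁, x₂, x₃` are `x 0, x 1, x 2`; the tangent space at each point is `ℝ³`. -/
abbrev Pt : Type := Fin 3 → ℝ

/-- Vector fields on `E(1,1)`. -/
abbrev VField : Type := Pt → Pt

/-- `X₁ = ∂_{x₃}`. -/
def X₁ : VField := fun _ => ![0, 0, 1]

/-- `X₂ = (1/√2) (-e^{x₃} ∂_{x₁} + e^{-x₃} ∂_{x₂})`. -/
def X₂ : VField := fun x => (1 / √2) • ![-Real.exp (x 2), Real.exp (-x 2), 0]

/-- `X₃ = -(1/√2) (e^{x₃} ∂_{x₁} + e^{-x₃} ∂_{x₂})`. -/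
def X₃ : VField := fun x => -(1 / √2) • ![Real.exp (x 2), Real.exp (-x 2), 0]

/-- `X̃₃ = L^{-1/2} X₃`. -/
def X₃L (L : ℝ) : VField := fun x => (√L)⁻¹ • X₃ x

/-- The coframe form `ω₁ = dx₃`. -/
def ω₁ (_x v : Pt) : ℝ := v 2

/-- The coframe form `ω₂ = (1/√2) (-e^{-x₃} dx₁ + e^{x₃} dx₂)`. -/
def ω₂ (x v : Pt) : ℝ := (1 / √2) * (-Real.exp (-x 2) * v 0 + Real.exp (x 2) * v 1)

/-- The contact form `ω = -(1/√2) (e^{-x₃} dx₁ + e^{x₃} dx₂)`, whose kernel is the horizontal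
distribution `span {X₁, X₂}`. -/
def ω (x v : Pt) : ℝ := -(1 / √2) * (Real.exp (-x 2) * v 0 + Real.exp (x 2) * v 1)

/-- The Riemannian metric `g_L = ω₁ ⊗ ω₁ + ω₂ ⊗ ω₂ + L ω ⊗ ω` at the point `x`. -/
def metric (L : ℝ) (x v w : Pt) : ℝ := ω₁ x v * ω₁ x w + ω₂ x v * ω₂ x w + L * (ω x v * ω x w)

/-- The derivative `V f` of a function along a vector field. -/
def along (V : VField) (f : Pt → ℝ) : Pt → ℝ := fun x => fderiv ℝ f x (V x)

/-- The coordinate vector field `∂_{x_i}`. -/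
def coord (i : Fin 3) : VField := fun _ => Pi.single i 1

/-- The coordinate matrix `(g_L)_{ij} = g_L(∂_i, ∂_j)`. -/
def gram (L : ℝ) (x : Pt) : Matrix (Fin 3) (Fin 3) ℝ :=
  Matrix.of fun i j => metric L x (coord i x) (coord j x)

/-- The Christoffel symbols of `g_L`,
`Γ^k_{ij} = ½ ∑_m g^{km} (∂_i g_{jm} + ∂_j g_{im} - ∂_m g_{ij})`. -/
def christoffel (L : ℝ) (k i j : Fin 3) (x : Pt) : ℝ :=
  (1 / 2) * ∑ m, (gram L x)⁻¹ k m *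
    (along (coord i) (fun y => gram L y j m) x + along (coord j) (fun y => gram L y i m) x
      - along (coord m) (fun y => gram L y i j) x)

/-- The Levi-Civita connection `∇^L_V W` of `g_L`. -/
def nabla (L : ℝ) (V W : VField) : VField := fun x k =>
  along V (fun y => W y k) x + ∑ i, ∑ j, christoffel L k i j x * V x i * W x j

/-- The curvature `R(X,Y)Z = ∇_X ∇_Y Z - ∇_Y ∇_X Z - ∇_{[X,Y]} Z` of a connection `D`. -/
def curvature (D : VField → VField → VField) (X Y Z : VField) : VField :=
  D X (D Y Z) - D Y (D X Z) - D (VectorField.lieBracket ℝ X Y) Z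

/-- The curvature tensor `R^L(a,b)c` of `∇^L` at the point `x`. By tensoriality, the tangent
vectors `a b c` may be extended to vector fields in any smooth way, here with constant
coordinates. -/
def curvatureTensor (L : ℝ) (x a b c : Pt) : Pt :=
  curvature (nabla L) (fun _ => a) (fun _ => b) (fun _ => c) x

/-- The surface `Σ₁ = {u = 0}`. -/
def surface (u : Pt → ℝ) : Set Pt := {x | u x = 0}

/-- The horizontal gradient `∇_H f = X₁(f) X₁ + X₂(f) X₂`. -/
def horizGrad (f : Pt → ℝ) : VField := fun x => along X₁ f x • X₁ x + along X₂ f x • X₂ x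

/-- The characteristic set `C(Σ₁) = {x ∈ Σ₁ : ∇_H u (x) = 0}`. -/
def characteristicSet (u : Pt → ℝ) : Set Pt := {x | x ∈ surface u ∧ horizGrad u x = 0}

/-- `p = X₁ u`. -/
def p (u : Pt → ℝ) : Pt → ℝ := along X₁ u

/-- `q = X₂ u`. -/
def q (u : Pt → ℝ) : Pt → ℝ := along X₂ u

/-- `r = X̃₃ u`. -/
def r (u : Pt → ℝ) (L : ℝ) : Pt → ℝ := along (X₃L L) u

/-- `l = |∇_H u| = √(p² + q²)`. -/
def l (u : Pt → ℝ) (x : Pt) : ℝ := √(p u x ^ 2 + q u x ^ 2)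

/-- `l_L = √(p² + q² + r²)`. -/
def lL (u : Pt → ℝ) (L : ℝ) (x : Pt) : ℝ := √(p u x ^ 2 + q u x ^ 2 + r u L x ^ 2)

/-- The Riemannian unit normal `v_L = (p/l_L) X₁ + (q/l_L) X₂ + (r/l_L) X̃₃` of `Σ₁`. -/
def normal (u : Pt → ℝ) (L : ℝ) : VField := fun x =>
  (p u x / lL u L x) • X₁ x + (q u x / lL u L x) • X₂ x + (r u L x / lL u L x) • X₃L L x

/-- The unit tangent field `e₁ = (q/l) X₁ - (p/l) X₂` of `Σ₁`. -/
def e₁ (u : Pt → ℝ) : VField := fun x => (q u x / l u x) • X₁ x - (p u x / l u x) • X₂ x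

/-- The unit tangent field `e₂ = (r/l_L)(p/l) X₁ + (r/l_L)(q/l) X₂ - (l/l_L) X̃₃` of `Σ₁`. -/
def e₂ (u : Pt → ℝ) (L : ℝ) : VField := fun x =>
  (r u L x / lL u L x * (p u x / l u x)) • X₁ x + (r u L x / lL u L x * (q u x / l u x)) • X₂ x
    - (l u x / lL u L x) • X₃L L x

/-- The second fundamental form `II^L`, with entries `⟨∇^L_{e_i} v_L, e_j⟩_L`. -/
def secondFundamentalForm (u : Pt → ℝ) (L : ℝ) (x : Pt) : Matrix (Fin 2) (Fin 2) ℝ :=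
  !![metric L x (nabla L (e₁ u) (normal u L) x) (e₁ u x),
      metric L x (nabla L (e₁ u) (normal u L) x) (e₂ u L x);
    metric L x (nabla L (e₂ u L) (normal u L) x) (e₁ u x),
      metric L x (nabla L (e₂ u L) (normal u L) x) (e₂ u L x)]

/-- The sectional curvature `-⟨R^L(e₁,e₂)e₁, e₂⟩_L` of `(E(1,1), g_L)` on the tangent plane of
`Σ₁`. -/
def ambientCurvature (u : Pt → ℝ) (L : ℝ) (x : Pt) : ℝ :=
  -metric L x (curvatureTensor L x (e₁ u x) (e₂ u L x) (e₁ u x)) (e₂ u L x)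

/-- The Riemannian Gaussian curvature of a `C²` surface in `(E(1,1), g_L)`: the sectional curvature
of the ambient space on the tangent plane plus the determinant of the second fundamental form. A
`C²` surface has a metric that is only `C¹`, so that the curvature tensor of its Levi-Civita
connection need not exist classically; compare `intrinsicGaussCurvature`. -/
def gaussCurvature (u : Pt → ℝ) (L : ℝ) (x : Pt) : ℝ :=
  ambientCurvature u L x + (secondFundamentalForm u L x).det

/-- The induced (Levi-Civita) connection `∇^{Σ₁,L}_V W = π ∇^L_V W`, where `π` is the
`g_L`-orthogonal projection to the tangent plane of the level surfaces of `u`, of which `Σ₁` is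
one. The value at a point of `Σ₁` only involves `W` on `Σ₁` if `V` is tangent to `Σ₁`. -/
def nablaSurface (u : Pt → ℝ) (L : ℝ) (V W : VField) : VField := fun x =>
  nabla L V W x - metric L x (nabla L V W x) (normal u L x) • normal u L x

/-- The Gaussian curvature `-⟨R^{Σ₁,L}(e₁,e₂)e₁, e₂⟩_{Σ₁,L}` from the curvature tensor of the
induced connection of `Σ₁`. -/
def intrinsicGaussCurvature (u : Pt → ℝ) (L : ℝ) (x : Pt) : ℝ :=
  -metric L x (curvature (nablaSurface u L) (e₁ u) (e₂ u L) (e₁ u) x) (e₂ u L x)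

/-- `-⟨e₁, ∇_H (X₃u / |∇_H u|)⟩ - (X₃u)² / l²`. The two vectors in the inner product are horizontal,
so that all metrics `g_L` give the same value. -/
def limitCurvature (u : Pt → ℝ) (x : Pt) : ℝ :=
  -metric 1 x (e₁ u x) (horizGrad (fun y => along X₃ u y / l u y) x)
    - along X₃ u x ^ 2 / l u x ^ 2

end E11

end

/-!
The metric `g_L` is left-invariant, so everything is computed in the frame `X₁, X₂, X₃` and its dual
coframe `ω₁, ω₂, ω`. The Christoffel symbols are needed only once, in `chr_coords`; from them come
the covariant derivative in the frame (`ω₁_nabla`, `ω₂_nabla`, `ω_nabla`), metric compatibility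
(`along_metric`), vanishing torsion (`nabla_sub_nabla`) and the sectional curvature of an arbitrary
plane (`neg_metric_curvatureTensor`).

*The limit.* Put `P = p/l`, `Q = q/l`, `h = X₃u/l` (`tilt`) and `k = l/l_L` (`horizRatio`). Then
`P² + Q² = 1`, `k² (1 + h²/L) = 1`, and the normal is `k (P X₁ + Q X₂) + (k h/L) X₃`. With these
coordinates the second fundamental form has the exact entries
* `II₁₁ = k (Q e₁(P) - P e₁(Q) - h P Q / L)`, which is bounded,
* `II₂₂ = O(1/L)`,
* `II₁₂ = II₂₁ = -L^{-1/2} (k² e₁(h) + (L + P² - Q²)/2)`.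

Both the sectional curvature of the tangent plane and `II₁₂²` grow like `L/4`. These terms cancel in
the Gaussian curvature, and what remains is a rational function of `1/L`, regular at `0`, whose value
there is `-h² - e₁(h)` (`gaussCurvature_eq`, `tendsto_gaussCurvature`). The symmetry of the second
fundamental form (`metric_nabla_normal_symm`) is where the second derivatives of `u` commute.

*The intrinsic curvature.* For `u` of class `C³` the frame `e₁, e₂` is of class `C²`, so that the
curvature of `∇^L` on these fields is the curvature tensor (`curvature_nabla`, by the symmetry of
second derivatives), and the Gauss equation (`metric_curvature_nablaSurface`) follows from metric
compatibility by differentiating `⟨e₁, v_L⟩_L = 0` and projecting.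
-/

namespace E11

/-! ### Christoffel symbols of `g_L` -/

/-- The bilinear map `∂_i ⊗ ∂_j ↦ ∂_k`. -/
noncomputable def elemBilin (k i j : Fin 3) : Pt →L[ℝ] Pt →L[ℝ] Pt :=
  (ContinuousLinearMap.proj (R := ℝ) (φ := fun _ : Fin 3 => ℝ) i).smulRight
    ((ContinuousLinearMap.proj (R := ℝ) (φ := fun _ : Fin 3 => ℝ) j).smulRight
      (Pi.single k (1 : ℝ) : Pt))

/-- The Christoffel symbols at `x`, assembled into the bilinear map
`(v, w) ↦ ∑ Γ^k_{ij} v^i w^j ∂_k`. As a map into continuous bilinear maps it can be differentiated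
without components. -/
noncomputable def chr (L : ℝ) (x : Pt) : Pt →L[ℝ] Pt →L[ℝ] Pt :=
  ∑ k, ∑ i, ∑ j, christoffel L k i j x • elemBilin k i j

theorem chr_apply (L : ℝ) (x v w : Pt) (k : Fin 3) :
    chr L x v w k = ∑ i, ∑ j, christoffel L k i j x * v i * w j := by
  simp [chr, elemBilin, Finset.sum_apply, Pi.single_apply, Finset.sum_ite_eq, mul_assoc]

theorem fderiv_comp_apply {W : VField} {x : Pt} (hW : DifferentiableAt ℝ W x) (v : Pt) (k : Fin 3) :
    fderiv ℝ (fun y => W y k) x v = fderiv ℝ W x v k := by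
  rw [fderiv_apply hW]; rfl

/-- The connection as the flat derivative plus the Christoffel term. Differentiability of `W` is what
makes the componentwise derivatives in `nabla` those of `W`. -/
theorem nabla_eq (L : ℝ) (V : VField) {W : VField} {x : Pt} (hW : DifferentiableAt ℝ W x) :
    nabla L V W x = fderiv ℝ W x (V x) + chr L x (V x) (W x) := by
  ext k
  simp only [nabla, along, Pi.add_apply, chr_apply]
  rw [fderiv_comp_apply hW]

theorem inv_sqrt_two_mul_self : (√2)⁻¹ * (√2)⁻¹ = (1 / 2 : ℝ) := by
  rw [← mul_inv, Real.mul_self_sqrt (by norm_num)]; norm_num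

theorem exp_neg_mul_exp (t : ℝ) : Real.exp (-t) * Real.exp t = 1 := by
  rw [← Real.exp_add]; simp

theorem gram_eq (L : ℝ) (x : Pt) : gram L x =
    !![(1 + L) / 2 * Real.exp (-x 2) ^ 2, (L - 1) / 2, 0;
       (L - 1) / 2, (1 + L) / 2 * Real.exp (x 2) ^ 2, 0;
       0, 0, 1] := by
  have h2 := inv_sqrt_two_mul_self
  have he := exp_neg_mul_exp (x 2)
  ext i j
  fin_cases i <;> fin_cases j <;>
    simp [gram, metric, ω₁, ω₂, ω, coord, Pi.single_apply]
  · linear_combination (1 + L) * Real.exp (-x 2) ^ 2 * h2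
  · linear_combination (L - 1) * (Real.exp (-x 2) * Real.exp (x 2)) * h2 + (L - 1) / 2 * he
  · linear_combination (L - 1) * (Real.exp (-x 2) * Real.exp (x 2)) * h2 + (L - 1) / 2 * he
  · linear_combination (1 + L) * Real.exp (x 2) ^ 2 * h2

theorem gram_inv_eq {L : ℝ} (hL : 0 < L) (x : Pt) : (gram L x)⁻¹ =
    !![(1 + L) / (2 * L) * Real.exp (x 2) ^ 2, -(L - 1) / (2 * L), 0;
       -(L - 1) / (2 * L), (1 + L) / (2 * L) * Real.exp (-x 2) ^ 2, 0;
       0, 0, 1] := by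
  have hE : Real.exp (-x 2) = (Real.exp (x 2))⁻¹ := Real.exp_neg _
  have := Real.exp_ne_zero (x 2)
  apply Matrix.inv_eq_right_inv
  rw [gram_eq, hE]
  ext i j
  fin_cases i <;> fin_cases j <;> simp [Matrix.mul_apply, Fin.sum_univ_three] <;> field_simp <;> ring

/-- The coefficients of `g_L` depend on `x₃` only, so this rule gives all their derivatives. -/
theorem along_of_third {f : ℝ → ℝ} {f' : ℝ} {x : Pt} (hf : HasDerivAt f f' (x 2)) (V : VField) :
    along V (fun y => f (y 2)) x = f' * V x 2 := by
  have h := hf.comp_hasFDerivAt x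
    (ContinuousLinearMap.proj (R := ℝ) (φ := fun _ : Fin 3 => ℝ) 2).hasFDerivAt
  have h' : HasFDerivAt (fun y : Pt => f (y 2)) _ x := h
  simp [along, h'.fderiv]

theorem hasDerivAt_exp_sq (t : ℝ) :
    HasDerivAt (fun s => Real.exp s ^ 2) (2 * Real.exp t ^ 2) t :=
  ((Real.hasDerivAt_exp t).fun_pow 2).congr_deriv (by norm_num; ring)

theorem hasDerivAt_exp_neg_sq (t : ℝ) :
    HasDerivAt (fun s => Real.exp (-s) ^ 2) (-2 * Real.exp (-t) ^ 2) t :=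
  ((hasDerivAt_neg t).exp.fun_pow 2).congr_deriv (by norm_num; ring)

theorem along_const (V : VField) (c : ℝ) (x : Pt) : along V (fun _ => c) x = 0 := by
  simp [along]

theorem along_gram (L : ℝ) (V : VField) (x : Pt) (i j : Fin 3) :
    along V (fun y => gram L y i j) x =
      V x 2 * (!![-(1 + L) * Real.exp (-x 2) ^ 2, 0, 0; 0, (1 + L) * Real.exp (x 2) ^ 2, 0; 0, 0, 0]
        : Matrix (Fin 3) (Fin 3) ℝ) i j := by
  simp only [gram_eq]
  have h1 := along_of_third ((hasDerivAt_exp_sq (x 2)).const_mul ((1 + L) / 2)) V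
  have h2 := along_of_third ((hasDerivAt_exp_neg_sq (x 2)).const_mul ((1 + L) / 2)) V
  fin_cases i <;> fin_cases j <;> simp [along_const]
  · rw [h2]; ring
  · rw [h1]; ring

/-- All Christoffel symbols of `g_L`, read off from the coordinates of `Γ(v, w)`. -/
theorem chr_coords {L : ℝ} (hL : 0 < L) (x v w : Pt) : chr L x v w =
    ![-(1 + L) ^ 2 / (4 * L) * (v 0 * w 2 + v 2 * w 0)
        - (L ^ 2 - 1) / (4 * L) * Real.exp (x 2) ^ 2 * (v 1 * w 2 + v 2 * w 1),
      (L ^ 2 - 1) / (4 * L) * Real.exp (-x 2) ^ 2 * (v 0 * w 2 + v 2 * w 0)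
        + (1 + L) ^ 2 / (4 * L) * (v 1 * w 2 + v 2 * w 1),
      (1 + L) / 2 * (Real.exp (-x 2) ^ 2 * (v 0 * w 0) - Real.exp (x 2) ^ 2 * (v 1 * w 1))] := by
  have hE : Real.exp (-x 2) = (Real.exp (x 2))⁻¹ := Real.exp_neg _
  have := Real.exp_ne_zero (x 2)
  ext k
  simp only [chr_apply, christoffel, along_gram, gram_inv_eq hL, Fin.sum_univ_three, coord]
  rw [hE]
  fin_cases k <;> simp <;> field_simp <;> ring

/-! ### The connection in the coframe `ω₁, ω₂, ω` -/

theorem ω₁_add (x v w : Pt) : ω₁ x (v + w) = ω₁ x v + ω₁ x w := rfl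
theorem ω₂_add (x v w : Pt) : ω₂ x (v + w) = ω₂ x v + ω₂ x w := by
  simp only [ω₂, Pi.add_apply]; ring
theorem ω_add (x v w : Pt) : ω x (v + w) = ω x v + ω x w := by
  simp only [ω, Pi.add_apply]; ring
theorem ω₁_sub (x v w : Pt) : ω₁ x (v - w) = ω₁ x v - ω₁ x w := rfl
theorem ω₂_sub (x v w : Pt) : ω₂ x (v - w) = ω₂ x v - ω₂ x w := by
  simp only [ω₂, Pi.sub_apply]; ring
theorem ω_sub (x v w : Pt) : ω x (v - w) = ω x v - ω x w := by
  simp only [ω, Pi.sub_apply]; ring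
theorem ω₁_smul (x : Pt) (c : ℝ) (v : Pt) : ω₁ x (c • v) = c * ω₁ x v := rfl
theorem ω₂_smul (x : Pt) (c : ℝ) (v : Pt) : ω₂ x (c • v) = c * ω₂ x v := by
  simp only [ω₂, Pi.smul_apply, smul_eq_mul]; ring
theorem ω_smul (x : Pt) (c : ℝ) (v : Pt) : ω x (c • v) = c * ω x v := by
  simp only [ω, Pi.smul_apply, smul_eq_mul]; ring

theorem ω₁_chr {L : ℝ} (hL : 0 < L) (x v w : Pt) :
    ω₁ x (chr L x v w) = (L + 1) / 2 * (ω₂ x v * ω x w + ω x v * ω₂ x w) := by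
  rw [chr_coords hL]
  simp [ω₁, ω₂, ω]
  linear_combination (1 + L) * (Real.exp (-x 2) ^ 2 * (v 0 * w 0) -
    Real.exp (x 2) ^ 2 * (v 1 * w 1)) * (-inv_sqrt_two_mul_self)

theorem ω₂_chr {L : ℝ} (hL : 0 < L) (x v w : Pt) :
    ω₂ x (chr L x v w) = -((L + 1) / 2) * (ω₁ x v * ω x w + ω x v * ω₁ x w) := by
  have hE : Real.exp (-x 2) = (Real.exp (x 2))⁻¹ := Real.exp_neg _
  have := Real.exp_ne_zero (x 2)
  rw [chr_coords hL]
  simp [ω₁, ω₂, ω]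
  rw [hE]
  field_simp
  ring

theorem ω_chr {L : ℝ} (hL : 0 < L) (x v w : Pt) :
    ω x (chr L x v w) = -((1 + 1 / L) / 2) * (ω₁ x v * ω₂ x w + ω₂ x v * ω₁ x w) := by
  have hE : Real.exp (-x 2) = (Real.exp (x 2))⁻¹ := Real.exp_neg _
  have := Real.exp_ne_zero (x 2)
  rw [chr_coords hL]
  simp [ω₁, ω₂, ω]
  rw [hE]
  field_simp
  ring

/-- `ω₁, ω₂, ω` is a coframe. -/
theorem ω_injective {x v w : Pt} (h₁ : ω₁ x v = ω₁ x w) (h₂ : ω₂ x v = ω₂ x w)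
    (h₃ : ω x v = ω x w) : v = w := by
  have h2 := inv_sqrt_two_mul_self
  have he := exp_neg_mul_exp (x 2)
  simp only [ω₁, ω₂, ω, one_div] at h₁ h₂ h₃
  ext i
  fin_cases i
  · simp only [Fin.zero_eta]
    linear_combination 2 * (Real.exp (x 2) * Real.exp (-x 2)) * (w 0 - v 0) * h2
      - (√2)⁻¹ * Real.exp (x 2) * (h₂ + h₃) + (w 0 - v 0) * he
  · simp only [Fin.mk_one]
    linear_combination 2 * (Real.exp (x 2) * Real.exp (-x 2)) * (w 1 - v 1) * h2
      + (√2)⁻¹ * Real.exp (-x 2) * (h₂ - h₃) + (w 1 - v 1) * he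
  · exact h₁

section Along

variable {f g : Pt → ℝ} {x : Pt} {V : VField}

theorem along_add (hf : DifferentiableAt ℝ f x) (hg : DifferentiableAt ℝ g x) :
    along V (fun y => f y + g y) x = along V f x + along V g x := by
  simp [along, fderiv_fun_add hf hg]

theorem along_sub (hf : DifferentiableAt ℝ f x) (hg : DifferentiableAt ℝ g x) :
    along V (fun y => f y - g y) x = along V f x - along V g x := by
  simp [along, fderiv_fun_sub hf hg]

theorem along_mul (hf : DifferentiableAt ℝ f x) (hg : DifferentiableAt ℝ g x) :
    along V (fun y => f y * g y) x = along V f x * g x + f x * along V g x := by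
  simp [along, fderiv_fun_mul hf hg]; ring

theorem along_const_mul (c : ℝ) (hf : DifferentiableAt ℝ f x) :
    along V (fun y => c * f y) x = c * along V f x := by
  simp [along, fderiv_const_mul hf]

end Along

section Coframe

variable {W : Pt → Pt} {x : Pt}

theorem differentiableAt_ω₁ (hW : DifferentiableAt ℝ W x) :
    DifferentiableAt ℝ (fun y => ω₁ y (W y)) x := by
  unfold ω₁; fun_prop

theorem differentiableAt_ω₂ (hW : DifferentiableAt ℝ W x) :
    DifferentiableAt ℝ (fun y => ω₂ y (W y)) x := by
  unfold ω₂; fun_prop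

theorem differentiableAt_ω (hW : DifferentiableAt ℝ W x) :
    DifferentiableAt ℝ (fun y => ω y (W y)) x := by
  unfold ω; fun_prop

theorem along_coord (hW : DifferentiableAt ℝ W x) (V : VField) (k : Fin 3) :
    along V (fun y => W y k) x = fderiv ℝ W x (V x) k := fderiv_comp_apply hW _ _

theorem along_ω₁ (hW : DifferentiableAt ℝ W x) (V : VField) :
    along V (fun y => ω₁ y (W y)) x = ω₁ x (fderiv ℝ W x (V x)) := along_coord hW V 2

theorem along_exp (V : VField) (x : Pt) :
    along V (fun y => Real.exp (y 2)) x = Real.exp (x 2) * V x 2 :=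
  along_of_third (Real.hasDerivAt_exp _) V

theorem along_exp_neg (V : VField) (x : Pt) :
    along V (fun y => Real.exp (-y 2)) x = -Real.exp (-x 2) * V x 2 :=
  along_of_third ((hasDerivAt_neg (x 2)).exp.congr_deriv (by ring)) V

/-- `V (ω₂(W))`; the second term is the derivative of the coefficients of `ω₂`, as `∂₃ ω₂ = -ω`. -/
theorem along_ω₂ (hW : DifferentiableAt ℝ W x) (V : VField) :
    along V (fun y => ω₂ y (W y)) x =
      ω₂ x (fderiv ℝ W x (V x)) - ω₁ x (V x) * ω x (W x) := by
  have h : (fun y => ω₂ y (W y)) =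
      fun y => (1 / √2) * (Real.exp (y 2) * W y 1 - Real.exp (-y 2) * W y 0) := by
    ext y; simp only [ω₂]; ring
  rw [h, along_const_mul _ (by fun_prop), along_sub (by fun_prop) (by fun_prop),
    along_mul (by fun_prop) (by fun_prop), along_mul (by fun_prop) (by fun_prop),
    along_exp, along_exp_neg, along_coord hW, along_coord hW]
  simp only [ω₁, ω₂, ω]; ring

/-- `V (ω(W))`; the second term is the derivative of the coefficients of `ω`, as `∂₃ ω = -ω₂`. -/
theorem along_ω (hW : DifferentiableAt ℝ W x) (V : VField) :
    along V (fun y => ω y (W y)) x =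
      ω x (fderiv ℝ W x (V x)) - ω₁ x (V x) * ω₂ x (W x) := by
  have h : (fun y => ω y (W y)) =
      fun y => -(1 / √2) * (Real.exp (y 2) * W y 1 + Real.exp (-y 2) * W y 0) := by
    ext y; simp only [ω]; ring
  rw [h, along_const_mul _ (by fun_prop), along_add (by fun_prop) (by fun_prop),
    along_mul (by fun_prop) (by fun_prop), along_mul (by fun_prop) (by fun_prop),
    along_exp, along_exp_neg, along_coord hW, along_coord hW]
  simp only [ω₁, ω₂, ω]; ring

variable {L : ℝ}

theorem ω₁_nabla (hL : 0 < L) (hW : DifferentiableAt ℝ W x) (V : VField) :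
    ω₁ x (nabla L V W x) = along V (fun y => ω₁ y (W y)) x
      + (L + 1) / 2 * (ω₂ x (V x) * ω x (W x) + ω x (V x) * ω₂ x (W x)) := by
  rw [nabla_eq L V hW, ω₁_add, along_ω₁ hW, ω₁_chr hL]

theorem ω₂_nabla (hL : 0 < L) (hW : DifferentiableAt ℝ W x) (V : VField) :
    ω₂ x (nabla L V W x) = along V (fun y => ω₂ y (W y)) x
      - (L - 1) / 2 * (ω₁ x (V x) * ω x (W x)) - (L + 1) / 2 * (ω x (V x) * ω₁ x (W x)) := by
  rw [nabla_eq L V hW, ω₂_add, along_ω₂ hW, ω₂_chr hL]; ring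

theorem ω_nabla (hL : 0 < L) (hW : DifferentiableAt ℝ W x) (V : VField) :
    ω x (nabla L V W x) = along V (fun y => ω y (W y)) x
      + (1 - 1 / L) / 2 * (ω₁ x (V x) * ω₂ x (W x))
      - (1 + 1 / L) / 2 * (ω₂ x (V x) * ω₁ x (W x)) := by
  rw [nabla_eq L V hW, ω_add, along_ω hW, ω_chr hL]; ring

theorem differentiableAt_metric (L : ℝ) {Z : Pt → Pt} (hW : DifferentiableAt ℝ W x)
    (hZ : DifferentiableAt ℝ Z x) : DifferentiableAt ℝ (fun y => metric L y (W y) (Z y)) x := by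
  have := differentiableAt_ω₁ hW
  have := differentiableAt_ω₂ hW
  have := differentiableAt_ω hW
  have := differentiableAt_ω₁ hZ
  have := differentiableAt_ω₂ hZ
  have := differentiableAt_ω hZ
  unfold metric; fun_prop

/-- `∇^L` is compatible with `g_L`. -/
theorem along_metric (hL : 0 < L) {Z : Pt → Pt} (hW : DifferentiableAt ℝ W x)
    (hZ : DifferentiableAt ℝ Z x) (V : VField) :
    along V (fun y => metric L y (W y) (Z y)) x =
      metric L x (nabla L V W x) (Z x) + metric L x (W x) (nabla L V Z x) := by
  have w1 := differentiableAt_ω₁ hW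
  have w2 := differentiableAt_ω₂ hW
  have w3 := differentiableAt_ω hW
  have z1 := differentiableAt_ω₁ hZ
  have z2 := differentiableAt_ω₂ hZ
  have z3 := differentiableAt_ω hZ
  simp only [metric]
  rw [along_add (by fun_prop) (by fun_prop), along_add (by fun_prop) (by fun_prop),
    along_const_mul _ (by fun_prop), along_mul w1 z1, along_mul w2 z2, along_mul w3 z3,
    ω₁_nabla hL hW, ω₂_nabla hL hW, ω_nabla hL hW, ω₁_nabla hL hZ, ω₂_nabla hL hZ, ω_nabla hL hZ]
  field_simp
  ring

end Coframe

/-! ### The ambient curvature -/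

theorem contDiff_chr {L : ℝ} (hL : 0 < L) : ContDiff ℝ 1 (chr L) := by
  refine contDiff_clm_apply_iff.2 fun v => contDiff_clm_apply_iff.2 fun w => ?_
  simp only [chr_coords hL]
  rw [contDiff_pi]
  intro k
  fin_cases k
  · change ContDiff ℝ 1 (fun y : Pt => -(1 + L) ^ 2 / (4 * L) * (v 0 * w 2 + v 2 * w 0)
      - (L ^ 2 - 1) / (4 * L) * Real.exp (y 2) ^ 2 * (v 1 * w 2 + v 2 * w 1))
    fun_prop
  · change ContDiff ℝ 1 (fun y : Pt => (L ^ 2 - 1) / (4 * L) * Real.exp (-y 2) ^ 2 *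
      (v 0 * w 2 + v 2 * w 0) + (1 + L) ^ 2 / (4 * L) * (v 1 * w 2 + v 2 * w 1))
    fun_prop
  · change ContDiff ℝ 1 (fun y : Pt => (1 + L) / 2 * (Real.exp (-y 2) ^ 2 * (v 0 * w 0)
      - Real.exp (y 2) ^ 2 * (v 1 * w 1)))
    fun_prop

theorem differentiable_chr {L : ℝ} (hL : 0 < L) : Differentiable ℝ (chr L) :=
  (contDiff_chr hL).differentiable one_ne_zero

/-- `∇^L` is torsion-free. -/
theorem chr_symm {L : ℝ} (hL : 0 < L) (x v w : Pt) : chr L x v w = chr L x w v := by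
  apply ω_injective (x := x)
  · simp only [ω₁_chr hL]; ring
  · simp only [ω₂_chr hL]; ring
  · simp only [ω_chr hL]; ring

theorem nabla_const {L : ℝ} (V : VField) (c : Pt) : nabla L V (fun _ => c) =
    fun x => chr L x (V x) c := by
  ext1 x
  rw [nabla_eq L V (differentiableAt_const c)]
  simp

theorem curvatureTensor_eq (L : ℝ) (x a b c : Pt) : curvatureTensor L x a b c =
    nabla L (fun _ => a) (fun y => chr L y b c) x - nabla L (fun _ => b) (fun y => chr L y a c) x := by
  have h : VectorField.lieBracket ℝ (fun _ : Pt => a) (fun _ => b) = 0 := by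
    ext1 y; simp [VectorField.lieBracket]
  simp [curvatureTensor, curvature, h, nabla_const]

/-- `-⟨R^L(a,b)a, b⟩_L` in the coframe. The curvature operator is diagonal in the frame, so that only
the squares of the coordinates of `a ∧ b` occur; the coefficients are the sectional curvatures of the
planes orthogonal to `X₁`, `X₂` and `X₃`. -/
theorem neg_metric_curvatureTensor {L : ℝ} (hL : 0 < L) (x a b : Pt) :
    -metric L x (curvatureTensor L x a b a) b =
      (L + 2 + 1 / L) / 4 * (L * (ω₂ x a * ω x b - ω x a * ω₂ x b) ^ 2)
      + (L - 2 - 3 / L) / 4 * (L * (ω₁ x a * ω x b - ω x a * ω₁ x b) ^ 2)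
      + (-3 * L - 2 + 1 / L) / 4 * (ω₁ x a * ω₂ x b - ω₂ x a * ω₁ x b) ^ 2 := by
  have hd : ∀ v w : Pt, DifferentiableAt ℝ (fun y => chr L y v w) x := fun v w =>
    ((differentiable_chr hL x).clm_apply (differentiableAt_const v)).clm_apply
      (differentiableAt_const w)
  have d1 : ∀ v : Pt, DifferentiableAt ℝ (fun y => ω₁ y v) x := fun v =>
    differentiableAt_ω₁ (differentiableAt_const v)
  have d2 : ∀ v : Pt, DifferentiableAt ℝ (fun y => ω₂ y v) x := fun v =>
    differentiableAt_ω₂ (differentiableAt_const v)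
  have d3 : ∀ v : Pt, DifferentiableAt ℝ (fun y => ω y v) x := fun v =>
    differentiableAt_ω (differentiableAt_const v)
  have a1 : ∀ (V : VField) (v : Pt), along V (fun y => ω₁ y v) x = 0 := fun V v => by
    rw [along_ω₁ (differentiableAt_const v)]; simp [ω₁]
  have a2 : ∀ (V : VField) (v : Pt), along V (fun y => ω₂ y v) x = -(ω₁ x (V x) * ω x v) :=
    fun V v => by rw [along_ω₂ (differentiableAt_const v)]; simp [ω₂]
  have a3 : ∀ (V : VField) (v : Pt), along V (fun y => ω y v) x = -(ω₁ x (V x) * ω₂ x v) :=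
    fun V v => by rw [along_ω (differentiableAt_const v)]; simp [ω]
  have c1 : ∀ (V : VField) (v w : Pt), along V (fun y => ω₁ y (chr L y v w)) x =
      (L + 1) / 2 * (along V (fun y => ω₂ y v) x * ω x w + ω₂ x v * along V (fun y => ω y w) x
        + (along V (fun y => ω y v) x * ω₂ x w + ω x v * along V (fun y => ω₂ y w) x)) := by
    intro V v w
    simp only [ω₁_chr hL]
    rw [along_const_mul _ (by fun_prop), along_add (by fun_prop) (by fun_prop),
      along_mul (d2 v) (d3 w), along_mul (d3 v) (d2 w)]
  have c2 : ∀ (V : VField) (v w : Pt), along V (fun y => ω₂ y (chr L y v w)) x =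
      -((L + 1) / 2) * (along V (fun y => ω₁ y v) x * ω x w + ω₁ x v * along V (fun y => ω y w) x
        + (along V (fun y => ω y v) x * ω₁ x w + ω x v * along V (fun y => ω₁ y w) x)) := by
    intro V v w
    simp only [ω₂_chr hL]
    rw [along_const_mul _ (by fun_prop), along_add (by fun_prop) (by fun_prop),
      along_mul (d1 v) (d3 w), along_mul (d3 v) (d1 w)]
  have c3 : ∀ (V : VField) (v w : Pt), along V (fun y => ω y (chr L y v w)) x =
      -((1 + 1 / L) / 2) * (along V (fun y => ω₁ y v) x * ω₂ x w
        + ω₁ x v * along V (fun y => ω₂ y w) x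
        + (along V (fun y => ω₂ y v) x * ω₁ x w + ω₂ x v * along V (fun y => ω₁ y w) x)) := by
    intro V v w
    simp only [ω_chr hL]
    rw [along_const_mul _ (by fun_prop), along_add (by fun_prop) (by fun_prop),
      along_mul (d1 v) (d2 w), along_mul (d2 v) (d1 w)]
  rw [curvatureTensor_eq]
  simp only [metric, ω₁_sub, ω₂_sub, ω_sub, ω₁_nabla hL (hd _ _), ω₂_nabla hL (hd _ _),
    ω_nabla hL (hd _ _)]
  simp only [c1, c2, c3, a1, a2, a3]
  simp only [ω₁_chr hL, ω₂_chr hL, ω_chr hL]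
  field_simp
  ring

/-! ### Curvature on vector fields and the Gauss equation -/

section Connection

variable {x : Pt} {L : ℝ} {V X Y Z W N : Pt → Pt}

theorem nabla_eventuallyEq (L : ℝ) (V : VField) (hZ : ContDiffAt ℝ 2 Z x) :
    nabla L V Z =ᶠ[𝓝 x] fun y => fderiv ℝ Z y (V y) + chr L y (V y) (Z y) := by
  filter_upwards [hZ.eventually (by simp)] with y hy
  exact nabla_eq L V (hy.differentiableAt two_ne_zero)

theorem hasFDerivAt_nabla (hL : 0 < L) (hV : DifferentiableAt ℝ V x) (hZ : ContDiffAt ℝ 2 Z x) :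
    HasFDerivAt (nabla L V Z) (fderiv ℝ (fun y => fderiv ℝ Z y (V y)) x +
      ((chr L x (V x)).comp (fderiv ℝ Z x) +
        ((chr L x).comp (fderiv ℝ V x) + (fderiv ℝ (chr L) x).flip (V x)).flip (Z x))) x := by
  have hZ' : DifferentiableAt ℝ Z x := hZ.differentiableAt two_ne_zero
  have h1 : DifferentiableAt ℝ (fderiv ℝ Z) x :=
    (hZ.fderiv_right (m := 1) (by norm_num)).differentiableAt one_ne_zero
  refine HasFDerivAt.congr_of_eventuallyEq ?_ (nabla_eventuallyEq L V hZ)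
  exact (h1.clm_apply hV).hasFDerivAt.add
    (((differentiable_chr hL x).hasFDerivAt.clm_apply hV.hasFDerivAt).clm_apply hZ'.hasFDerivAt)

/-- The curvature of `∇^L` is tensorial. Both sides equal
`(D_X Γ)(Y, Z) - (D_Y Γ)(X, Z) + Γ(X, Γ(Y, Z)) - Γ(Y, Γ(X, Z))` at `x`: the derivatives of `X` and `Y`
cancel against the bracket, and the second derivatives of `Z` commute. -/
theorem curvature_nabla (hL : 0 < L) (hX : DifferentiableAt ℝ X x) (hY : DifferentiableAt ℝ Y x)
    (hZ : ContDiffAt ℝ 2 Z x) :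
    curvature (nabla L) X Y Z x = curvatureTensor L x (X x) (Y x) (Z x) := by
  have key : ∀ {X Y Z : Pt → Pt}, DifferentiableAt ℝ X x → DifferentiableAt ℝ Y x →
      ContDiffAt ℝ 2 Z x → curvature (nabla L) X Y Z x =
        fderiv ℝ (chr L) x (X x) (Y x) (Z x) - fderiv ℝ (chr L) x (Y x) (X x) (Z x)
        + chr L x (X x) (chr L x (Y x) (Z x)) - chr L x (Y x) (chr L x (X x) (Z x)) := by
    intro X Y Z hX hY hZ
    have hZ' : DifferentiableAt ℝ Z x := hZ.differentiableAt two_ne_zero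
    have b := VectorField.fderiv_apply_lieBracket hZ (by simp) hY hX
    have dY := hasFDerivAt_nabla hL hY hZ
    have dX := hasFDerivAt_nabla hL hX hZ
    have e : curvature (nabla L) X Y Z x = nabla L X (nabla L Y Z) x - nabla L Y (nabla L X Z) x
      - nabla L (VectorField.lieBracket ℝ X Y) Z x := rfl
    rw [e, nabla_eq L X dY.differentiableAt, nabla_eq L Y dX.differentiableAt, dX.fderiv,
      dY.fderiv, nabla_eq L (VectorField.lieBracket ℝ X Y) hZ', b, nabla_eq L X hZ',
      nabla_eq L Y hZ']
    simp only [VectorField.lieBracket, _root_.add_apply,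
      ContinuousLinearMap.comp_apply, ContinuousLinearMap.flip_apply, map_add, map_sub,
      _root_.sub_apply]
    abel
  -- The right-hand side of `key` only involves the values at `x`, so constant fields give the same.
  rw [key hX hY hZ]
  exact (key (differentiableAt_const _) (differentiableAt_const _) contDiffAt_const).symm

theorem nabla_sub_smul {f : Pt → ℝ} (L : ℝ) (X : VField) (hf : DifferentiableAt ℝ f x)
    (hV : DifferentiableAt ℝ V x) (hN : DifferentiableAt ℝ N x) :
    nabla L X (fun y => V y - f y • N y) x =
      nabla L X V x - (along X f x • N x + f x • nabla L X N x) := by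
  have hs : DifferentiableAt ℝ (fun y => f y • N y) x := hf.smul hN
  rw [nabla_eq L X (hV.fun_sub hs), nabla_eq L X hV, nabla_eq L X hN, fderiv_fun_sub hV hs,
    fderiv_fun_smul hf hN]
  simp [along]
  module

theorem nabla_sub_nabla (hL : 0 < L) (hV : DifferentiableAt ℝ V x) (hW : DifferentiableAt ℝ W x) :
    nabla L V W x - nabla L W V x = VectorField.lieBracket ℝ V W x := by
  rw [nabla_eq L V hW, nabla_eq L W hV, chr_symm hL x (W x), VectorField.lieBracket]
  abel

theorem metric_comm (L : ℝ) (x v w : Pt) : metric L x v w = metric L x w v := by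
  simp only [metric]; ring

theorem metric_sub_left (L : ℝ) (x v v' w : Pt) :
    metric L x (v - v') w = metric L x v w - metric L x v' w := by
  simp only [metric, ω₁_sub, ω₂_sub, ω_sub]; ring

theorem metric_add_left (L : ℝ) (x v v' w : Pt) :
    metric L x (v + v') w = metric L x v w + metric L x v' w := by
  simp only [metric, ω₁_add, ω₂_add, ω_add]; ring

theorem metric_smul_left (L : ℝ) (x : Pt) (c : ℝ) (v w : Pt) :
    metric L x (c • v) w = c * metric L x v w := by
  simp only [metric, ω₁_smul, ω₂_smul, ω_smul]; ring

/-- The derivative of `⟨N, W⟩_L = 0`. -/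
theorem metric_nabla_eq_neg (hL : 0 < L) (hW : DifferentiableAt ℝ W x)
    (hN : DifferentiableAt ℝ N x) (h0 : ∀ᶠ y in 𝓝 x, metric L y (N y) (W y) = 0) (V : VField) :
    metric L x (nabla L V N x) (W x) = -metric L x (nabla L V W x) (N x) := by
  have h := along_metric hL hN hW V
  have e : (fun y => metric L y (N y) (W y)) =ᶠ[𝓝 x] fun _ => 0 := h0
  rw [along, e.fderiv_eq, metric_comm L x (N x)] at h
  simp at h
  linarith

/-- The second covariant derivative in the induced connection. With `f = ⟨∇_Y Z, v_L⟩`, the term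
`X(f) v_L` in `∇_X (∇_Y Z - f v_L)` and the outer projection vanish against a tangent vector `w`. -/
theorem metric_nabla_nablaSurface (u : Pt → ℝ) (hL : 0 < L) (hN : DifferentiableAt ℝ (normal u L) x)
    (hY : DifferentiableAt ℝ Y x) (hZ : ContDiffAt ℝ 2 Z x) (X : VField) {w : Pt}
    (hw : metric L x (normal u L x) w = 0) :
    metric L x (nablaSurface u L X (nablaSurface u L Y Z) x) w =
      metric L x (nabla L X (nabla L Y Z) x) w
        - metric L x (nabla L Y Z x) (normal u L x) * metric L x (nabla L X (normal u L) x) w := by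
  have hd := (hasFDerivAt_nabla hL hY hZ).differentiableAt
  have e := nabla_sub_smul L X (differentiableAt_metric L hd hN) hd hN
  rw [nablaSurface, metric_sub_left, metric_smul_left, hw]
  change metric L x (nabla L X (fun y => nabla L Y Z y -
    metric L y (nabla L Y Z y) (normal u L y) • normal u L y) x) w - _ = _
  rw [e]
  simp only [metric_sub_left, metric_add_left, metric_smul_left, hw]
  ring

/-- The Gauss equation. -/
theorem metric_curvature_nablaSurface (u : Pt → ℝ) (hL : 0 < L)
    (hN : DifferentiableAt ℝ (normal u L) x)
    (hX : DifferentiableAt ℝ X x) (hY : DifferentiableAt ℝ Y x) (hZ : ContDiffAt ℝ 2 Z x)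
    (hZN : ∀ᶠ y in 𝓝 x, metric L y (normal u L y) (Z y) = 0) {w : Pt}
    (hw : metric L x (normal u L x) w = 0) :
    metric L x (curvature (nablaSurface u L) X Y Z x) w =
      metric L x (curvatureTensor L x (X x) (Y x) (Z x)) w
        + metric L x (nabla L Y (normal u L) x) (Z x) * metric L x (nabla L X (normal u L) x) w
        - metric L x (nabla L X (normal u L) x) (Z x) * metric L x (nabla L Y (normal u L) x) w := by
  have hZ' : DifferentiableAt ℝ Z x := hZ.differentiableAt two_ne_zero
  -- No torsion is needed: the bracket term is the same for both connections against `w`.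
  have e : ∀ D, curvature D X Y Z x = D X (D Y Z) x - D Y (D X Z) x
      - D (VectorField.lieBracket ℝ X Y) Z x := fun D => rfl
  rw [← curvature_nabla hL hX hY hZ, e, e]
  simp only [metric_sub_left, metric_nabla_nablaSurface u hL hN hY hZ X hw,
    metric_nabla_nablaSurface u hL hN hX hZ Y hw, metric_nabla_eq_neg hL hZ' hN hZN]
  rw [nablaSurface, metric_sub_left, metric_smul_left, hw]
  ring

end Connection

/-! ### The frame `X₁, X₂, X₃` -/

section Frame

theorem ω₁_X₁ (x : Pt) : ω₁ x (X₁ x) = 1 := by simp [ω₁, X₁]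
theorem ω₂_X₁ (x : Pt) : ω₂ x (X₁ x) = 0 := by simp [ω₂, X₁]
theorem ω_X₁ (x : Pt) : ω x (X₁ x) = 0 := by simp [ω, X₁]
theorem ω₁_X₂ (x : Pt) : ω₁ x (X₂ x) = 0 := by simp [ω₁, X₂]
theorem ω₂_X₂ (x : Pt) : ω₂ x (X₂ x) = 1 := by
  simp [ω₂, X₂]
  linear_combination 2 * (Real.exp (-x 2) * Real.exp (x 2)) * inv_sqrt_two_mul_self
    + exp_neg_mul_exp (x 2)
theorem ω_X₂ (x : Pt) : ω x (X₂ x) = 0 := by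
  simp [ω, X₂]
  ring
theorem ω₁_X₃ (x : Pt) : ω₁ x (X₃ x) = 0 := by simp [ω₁, X₃]
theorem ω₂_X₃ (x : Pt) : ω₂ x (X₃ x) = 0 := by
  simp [ω₂, X₃]
  ring
theorem ω_X₃ (x : Pt) : ω x (X₃ x) = 1 := by
  simp [ω, X₃]
  linear_combination 2 * (Real.exp (-x 2) * Real.exp (x 2)) * inv_sqrt_two_mul_self
    + exp_neg_mul_exp (x 2)

theorem eq_frame_sum (x v : Pt) : v = ω₁ x v • X₁ x + ω₂ x v • X₂ x + ω x v • X₃ x := by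
  apply ω_injective (x := x) <;>
    simp [ω₁_add, ω₂_add, ω_add, ω₁_smul, ω₂_smul, ω_smul, ω₁_X₁, ω₂_X₁, ω_X₁, ω₁_X₂, ω₂_X₂, ω_X₂,
      ω₁_X₃, ω₂_X₃, ω_X₃]

theorem along_eq (V : VField) (f : Pt → ℝ) (x : Pt) : along V f x =
    ω₁ x (V x) * along X₁ f x + ω₂ x (V x) * along X₂ f x + ω x (V x) * along X₃ f x := by
  simp only [along]
  conv_lhs => rw [eq_frame_sum x (V x)]
  simp

theorem contDiff_X₁ {n : WithTop ℕ∞} : ContDiff ℝ n X₁ := contDiff_const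

theorem contDiff_X₂ {n : WithTop ℕ∞} : ContDiff ℝ n X₂ := by
  unfold X₂
  refine ContDiff.const_smul _ (contDiff_pi.2 fun i => ?_)
  fin_cases i
  · change ContDiff ℝ n (fun x : Pt => -Real.exp (x 2)); fun_prop
  · change ContDiff ℝ n (fun x : Pt => Real.exp (-x 2)); fun_prop
  · exact contDiff_const

theorem contDiff_X₃ {n : WithTop ℕ∞} : ContDiff ℝ n X₃ := by
  unfold X₃
  refine ContDiff.const_smul _ (contDiff_pi.2 fun i => ?_)
  fin_cases i
  · change ContDiff ℝ n (fun x : Pt => Real.exp (x 2)); fun_prop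
  · change ContDiff ℝ n (fun x : Pt => Real.exp (-x 2)); fun_prop
  · exact contDiff_const

theorem contDiff_X₃L {n : WithTop ℕ∞} (L : ℝ) : ContDiff ℝ n (X₃L L) :=
  contDiff_X₃.const_smul _

theorem ContDiffAt.along {n : WithTop ℕ∞} {V : VField} {f : Pt → ℝ} {x : Pt}
    (hf : ContDiffAt ℝ (n + 1) f x) (hV : ContDiff ℝ n V) : ContDiffAt ℝ n (along V f) x :=
  (hf.fderiv_right le_rfl).clm_apply hV.contDiffAt

end Frame

/-! ### The adapted frame `v_L, e₁, e₂` of the surface -/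

section Surface

variable {u : Pt → ℝ} {L : ℝ} {x : Pt}

theorem l_ne_zero_of_notMem (hx : x ∈ surface u) (hchar : x ∉ characteristicSet u) :
    l u x ≠ 0 := by
  intro h
  apply hchar
  refine ⟨hx, ?_⟩
  have h0 : p u x ^ 2 + q u x ^ 2 = 0 := (Real.sqrt_eq_zero (by positivity)).1 h
  have hp : p u x = 0 := by nlinarith [sq_nonneg (p u x), sq_nonneg (q u x)]
  have hq : q u x = 0 := by nlinarith [sq_nonneg (p u x), sq_nonneg (q u x)]
  simp only [p, q] at hp hq
  simp [horizGrad, hp, hq]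

theorem l_sq (u : Pt → ℝ) (x : Pt) : l u x ^ 2 = p u x ^ 2 + q u x ^ 2 :=
  Real.sq_sqrt (by positivity)

theorem lL_sq (u : Pt → ℝ) (L : ℝ) (x : Pt) :
    lL u L x ^ 2 = p u x ^ 2 + q u x ^ 2 + r u L x ^ 2 :=
  Real.sq_sqrt (by positivity)

theorem lL_ne_zero (hl : l u x ≠ 0) : lL u L x ≠ 0 := by
  intro h
  have h1 := lL_sq u L x
  have h2 := l_sq u x
  rw [h] at h1
  have : 0 < l u x ^ 2 := by positivity
  nlinarith [sq_nonneg (r u L x)]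

theorem r_eq (u : Pt → ℝ) (L : ℝ) (x : Pt) : r u L x = (√L)⁻¹ * along X₃ u x := by
  simp [r, along, X₃L]

theorem inv_sqrt_sq (hL : 0 < L) : (√L)⁻¹ ^ 2 = 1 / L := by
  rw [inv_pow, Real.sq_sqrt hL.le, one_div]

theorem mul_inv_sqrt_sq (hL : 0 < L) : L * (√L)⁻¹ ^ 2 = 1 := by
  rw [inv_sqrt_sq hL]; field_simp

theorem ω₁_e₁ (u : Pt → ℝ) (x : Pt) : ω₁ x (e₁ u x) = q u x / l u x := by
  simp [e₁, ω₁_sub, ω₁_smul, ω₁_X₁, ω₁_X₂]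
theorem ω₂_e₁ (u : Pt → ℝ) (x : Pt) : ω₂ x (e₁ u x) = -(p u x / l u x) := by
  simp [e₁, ω₂_sub, ω₂_smul, ω₂_X₁, ω₂_X₂]
theorem ω_e₁ (u : Pt → ℝ) (x : Pt) : ω x (e₁ u x) = 0 := by
  simp [e₁, ω_sub, ω_smul, ω_X₁, ω_X₂]

theorem ω₁_e₂ (u : Pt → ℝ) (L : ℝ) (x : Pt) :
    ω₁ x (e₂ u L x) = r u L x / lL u L x * (p u x / l u x) := by
  simp [e₂, X₃L, ω₁_sub, ω₁_add, ω₁_smul, ω₁_X₁, ω₁_X₂, ω₁_X₃]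
theorem ω₂_e₂ (u : Pt → ℝ) (L : ℝ) (x : Pt) :
    ω₂ x (e₂ u L x) = r u L x / lL u L x * (q u x / l u x) := by
  simp [e₂, X₃L, ω₂_sub, ω₂_add, ω₂_smul, ω₂_X₁, ω₂_X₂, ω₂_X₃]
theorem ω_e₂ (u : Pt → ℝ) (L : ℝ) (x : Pt) :
    ω x (e₂ u L x) = -(l u x / lL u L x * (√L)⁻¹) := by
  simp [e₂, X₃L, ω_sub, ω_add, ω_smul, ω_X₁, ω_X₂, ω_X₃]

theorem ω₁_normal (u : Pt → ℝ) (L : ℝ) (x : Pt) : ω₁ x (normal u L x) = p u x / lL u L x := by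
  simp [normal, X₃L, ω₁_add, ω₁_smul, ω₁_X₁, ω₁_X₂, ω₁_X₃]
theorem ω₂_normal (u : Pt → ℝ) (L : ℝ) (x : Pt) : ω₂ x (normal u L x) = q u x / lL u L x := by
  simp [normal, X₃L, ω₂_add, ω₂_smul, ω₂_X₁, ω₂_X₂, ω₂_X₃]
theorem ω_normal (u : Pt → ℝ) (L : ℝ) (x : Pt) :
    ω x (normal u L x) = r u L x / lL u L x * (√L)⁻¹ := by
  simp [normal, X₃L, ω_add, ω_smul, ω_X₁, ω_X₂, ω_X₃]

section Regularity

variable {n : WithTop ℕ∞}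

theorem contDiffAt_p (hu : ContDiffAt ℝ (n + 1) u x) : ContDiffAt ℝ n (p u) x :=
  ContDiffAt.along hu contDiff_X₁
theorem contDiffAt_q (hu : ContDiffAt ℝ (n + 1) u x) : ContDiffAt ℝ n (q u) x :=
  ContDiffAt.along hu contDiff_X₂
theorem contDiffAt_r (hu : ContDiffAt ℝ (n + 1) u x) (L : ℝ) : ContDiffAt ℝ n (r u L) x :=
  ContDiffAt.along hu (contDiff_X₃L L)

theorem contDiffAt_l (hu : ContDiffAt ℝ (n + 1) u x) (hl : l u x ≠ 0) :
    ContDiffAt ℝ n (l u) x := by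
  refine ContDiffAt.sqrt (((contDiffAt_p hu).pow 2).add ((contDiffAt_q hu).pow 2)) ?_
  rw [← l_sq]
  positivity

theorem contDiffAt_lL (hu : ContDiffAt ℝ (n + 1) u x) (hl : l u x ≠ 0) (L : ℝ) :
    ContDiffAt ℝ n (lL u L) x := by
  refine ContDiffAt.sqrt ((((contDiffAt_p hu).pow 2).add ((contDiffAt_q hu).pow 2)).add
    ((contDiffAt_r hu L).pow 2)) ?_
  rw [← lL_sq]
  have := lL_ne_zero (L := L) hl
  positivity

theorem contDiffAt_e₁ (hu : ContDiffAt ℝ (n + 1) u x) (hl : l u x ≠ 0) :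
    ContDiffAt ℝ n (e₁ u) x :=
  (((contDiffAt_q hu).div (contDiffAt_l hu hl) hl).smul contDiff_X₁.contDiffAt).sub
    (((contDiffAt_p hu).div (contDiffAt_l hu hl) hl).smul contDiff_X₂.contDiffAt)

theorem contDiffAt_e₂ (hu : ContDiffAt ℝ (n + 1) u x) (hl : l u x ≠ 0) (L : ℝ) :
    ContDiffAt ℝ n (e₂ u L) x := by
  have h0 := lL_ne_zero (L := L) hl
  have hll := contDiffAt_l hu hl
  have hlL := contDiffAt_lL hu hl L
  have hr := (contDiffAt_r hu L).div hlL h0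
  exact (((hr.mul ((contDiffAt_p hu).div hll hl)).smul contDiff_X₁.contDiffAt).add
    ((hr.mul ((contDiffAt_q hu).div hll hl)).smul contDiff_X₂.contDiffAt)).sub
    ((hll.div hlL h0).smul (contDiff_X₃L L).contDiffAt)

theorem contDiffAt_normal (hu : ContDiffAt ℝ (n + 1) u x) (hl : l u x ≠ 0) (L : ℝ) :
    ContDiffAt ℝ n (normal u L) x := by
  have h0 := lL_ne_zero (L := L) hl
  have hlL := contDiffAt_lL hu hl L
  exact ((((contDiffAt_p hu).div hlL h0).smul contDiff_X₁.contDiffAt).add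
    (((contDiffAt_q hu).div hlL h0).smul contDiff_X₂.contDiffAt)).add
    (((contDiffAt_r hu L).div hlL h0).smul (contDiff_X₃L L).contDiffAt)

end Regularity

/-- `v_L` is the normalized `g_L`-gradient of `u`. -/
theorem metric_normal (hL : 0 < L) (V : VField) :
    metric L x (normal u L x) (V x) = along V u x / lL u L x := by
  have := mul_inv_sqrt_sq hL
  rw [along_eq V u x]
  simp only [metric, ω₁_normal, ω₂_normal, ω_normal, r_eq, p, q]
  linear_combination (along X₃ u x / lL u L x * ω x (V x)) * this

theorem along_e₁_self (u : Pt → ℝ) (x : Pt) : along (e₁ u) u x = 0 := by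
  rw [along_eq, ω₁_e₁, ω₂_e₁, ω_e₁]
  simp only [p, q]; ring

theorem along_e₂_self (L : ℝ) (hl : l u x ≠ 0) : along (e₂ u L) u x = 0 := by
  rw [along_eq, ω₁_e₂, ω₂_e₂, ω_e₂]
  have h := l_sq u x
  rw [r_eq]
  simp only [p, q] at *
  field_simp
  rw [h]; ring

theorem eventually_l_ne_zero (hu : ContDiffAt ℝ 2 u x) (hl : l u x ≠ 0) :
    ∀ᶠ y in 𝓝 x, l u y ≠ 0 :=
  (contDiffAt_l (n := 1) hu hl).continuousAt.eventually_ne hl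

/-- The second fundamental form is symmetric: `⟨∇_{e₁} v_L, e₂⟩ - ⟨∇_{e₂} v_L, e₁⟩` is
`-⟨v_L, [e₁, e₂]⟩ = -[e₁, e₂]u / l_L`, which vanishes as `e₁ u = e₂ u = 0` near `x`. -/
theorem metric_nabla_normal_symm (hL : 0 < L) (hu : ContDiffAt ℝ 2 u x) (hl : l u x ≠ 0) :
    metric L x (nabla L (e₂ u L) (normal u L) x) (e₁ u x) =
      metric L x (nabla L (e₁ u) (normal u L) x) (e₂ u L x) := by
  have d1 := (contDiffAt_e₁ (n := 1) hu hl).differentiableAt one_ne_zero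
  have d2 := (contDiffAt_e₂ (n := 1) hu hl L).differentiableAt one_ne_zero
  have dN := (contDiffAt_normal (n := 1) hu hl L).differentiableAt one_ne_zero
  have hev := eventually_l_ne_zero hu hl
  have t1 : ∀ᶠ y in 𝓝 x, metric L y (normal u L y) (e₁ u y) = 0 := .of_forall fun y => by
    rw [metric_normal hL, along_e₁_self, zero_div]
  have t2 : ∀ᶠ y in 𝓝 x, metric L y (normal u L y) (e₂ u L y) = 0 := hev.mono fun y hy => by
    rw [metric_normal hL, along_e₂_self L hy, zero_div]
  have b := VectorField.fderiv_apply_lieBracket hu (by simp) d2 d1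
  have z1 : (fun y => fderiv ℝ u y (e₁ u y)) =ᶠ[𝓝 x] fun _ => 0 :=
    .of_forall fun y => along_e₁_self u y
  have z2 : (fun y => fderiv ℝ u y (e₂ u L y)) =ᶠ[𝓝 x] fun _ => 0 :=
    hev.mono fun y hy => along_e₂_self L hy
  rw [z1.fderiv_eq, z2.fderiv_eq] at b
  have c := metric_normal (u := u) (x := x) hL (VectorField.lieBracket ℝ (e₁ u) (e₂ u L))
  rw [along, b, ← nabla_sub_nabla hL d1 d2, metric_comm, metric_sub_left] at c
  rw [metric_nabla_eq_neg hL d1 dN t1, metric_nabla_eq_neg hL d2 dN t2]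
  simp at c
  linarith

theorem intrinsicGaussCurvature_eq (hL : 0 < L) (hu : ContDiffAt ℝ 3 u x) (hl : l u x ≠ 0) :
    intrinsicGaussCurvature u L x = gaussCurvature u L x := by
  have hu' : ContDiffAt ℝ 2 u x := hu.of_le (by norm_num)
  have hu3 : ContDiffAt ℝ (2 + 1) u x := hu.of_le (by norm_num)
  have d1 := contDiffAt_e₁ (n := 2) hu3 hl
  have d2 := (contDiffAt_e₂ (n := 2) hu3 hl L).differentiableAt two_ne_zero
  have dN := (contDiffAt_normal (n := 2) hu3 hl L).differentiableAt two_ne_zero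
  have t1 : ∀ᶠ y in 𝓝 x, metric L y (normal u L y) (e₁ u y) = 0 := .of_forall fun y => by
    rw [metric_normal hL, along_e₁_self, zero_div]
  have t2 : metric L x (normal u L x) (e₂ u L x) = 0 := by
    rw [metric_normal hL, along_e₂_self L hl, zero_div]
  rw [intrinsicGaussCurvature, gaussCurvature, ambientCurvature, secondFundamentalForm,
    Matrix.det_fin_two_of,
    metric_curvature_nablaSurface u hL dN (d1.differentiableAt two_ne_zero) d2 d1 t1 t2]
  ring

/-! ### The second fundamental form -/

/-- `h = X₃u / |∇_H u|`, the ratio of the vertical to the horizontal part of the gradient. It does not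
depend on `L`, as it uses `X₃` instead of `X̃₃`. -/
noncomputable def tilt (u : Pt → ℝ) (y : Pt) : ℝ := along X₃ u y / l u y

/-- `k = l / l_L`, the length of the horizontal part of the unit normal `v_L`. -/
noncomputable def horizRatio (u : Pt → ℝ) (L : ℝ) (y : Pt) : ℝ := l u y / lL u L y

theorem horizNormal_sq (hl : l u x ≠ 0) : (p u x / l u x) ^ 2 + (q u x / l u x) ^ 2 = 1 := by
  have h := l_sq u x
  field_simp
  rw [h]

theorem horizRatio_sq (hL : 0 < L) (hl : l u x ≠ 0) :
    horizRatio u L x ^ 2 * (1 + tilt u x ^ 2 * (1 / L)) = 1 := by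
  have h0 := lL_ne_zero (L := L) hl
  have h := lL_sq u L x
  rw [← l_sq, r_eq, mul_pow, inv_sqrt_sq hL] at h
  rw [horizRatio, tilt]
  field_simp
  field_simp at h
  rw [h]

theorem differentiableAt_p_div_l (hu : ContDiffAt ℝ 2 u x) (hl : l u x ≠ 0) :
    DifferentiableAt ℝ (fun y => p u y / l u y) x :=
  ((contDiffAt_p (n := 1) hu).div (contDiffAt_l hu hl) hl).differentiableAt one_ne_zero

theorem differentiableAt_q_div_l (hu : ContDiffAt ℝ 2 u x) (hl : l u x ≠ 0) :
    DifferentiableAt ℝ (fun y => q u y / l u y) x :=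
  ((contDiffAt_q (n := 1) hu).div (contDiffAt_l hu hl) hl).differentiableAt one_ne_zero

theorem differentiableAt_tilt (hu : ContDiffAt ℝ 2 u x) (hl : l u x ≠ 0) :
    DifferentiableAt ℝ (tilt u) x :=
  ((ContDiffAt.along (n := 1) hu contDiff_X₃).div (contDiffAt_l hu hl) hl).differentiableAt
    one_ne_zero

theorem differentiableAt_horizRatio (hu : ContDiffAt ℝ 2 u x) (hl : l u x ≠ 0) (L : ℝ) :
    DifferentiableAt ℝ (horizRatio u L) x :=
  ((contDiffAt_l (n := 1) hu hl).div (contDiffAt_lL hu hl L) (lL_ne_zero hl)).differentiableAt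
    one_ne_zero

/-- The horizontal unit normal `(p/l, q/l)` is orthogonal to its derivatives, having length `1`. -/
theorem horizNormal_mul_along (hu : ContDiffAt ℝ 2 u x) (hl : l u x ≠ 0) (V : VField) :
    p u x / l u x * along V (fun y => p u y / l u y) x
      + q u x / l u x * along V (fun y => q u y / l u y) x = 0 := by
  have dP := differentiableAt_p_div_l hu hl
  have dQ := differentiableAt_q_div_l hu hl
  have hunit : (fun y => p u y / l u y * (p u y / l u y) + q u y / l u y * (q u y / l u y)) =ᶠ[𝓝 x]
      fun _ => 1 := (eventually_l_ne_zero hu hl).mono fun y hy => by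
    simpa only [sq] using horizNormal_sq hy
  have h : along V (fun y => p u y / l u y * (p u y / l u y) + q u y / l u y * (q u y / l u y)) x
      = 0 := by
    rw [along, hunit.fderiv_eq]; simp
  rw [along_add (dP.fun_mul dP) (dQ.fun_mul dQ), along_mul dP dP, along_mul dQ dQ] at h
  linear_combination h / 2

theorem ω₁_normal_eq (hl : l u x ≠ 0) (L : ℝ) :
    ω₁ x (normal u L x) = horizRatio u L x * (p u x / l u x) := by
  have := lL_ne_zero (L := L) hl
  rw [ω₁_normal, horizRatio]; field_simp

theorem ω₂_normal_eq (hl : l u x ≠ 0) (L : ℝ) :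
    ω₂ x (normal u L x) = horizRatio u L x * (q u x / l u x) := by
  have := lL_ne_zero (L := L) hl
  rw [ω₂_normal, horizRatio]; field_simp

theorem ω_normal_eq (hL : 0 < L) (hl : l u x ≠ 0) :
    ω x (normal u L x) = 1 / L * (horizRatio u L x * tilt u x) := by
  have := lL_ne_zero (L := L) hl
  rw [ω_normal, horizRatio, tilt, ← inv_sqrt_sq hL, r_eq]; field_simp

theorem ω₁_nabla_normal (hL : 0 < L) (hu : ContDiffAt ℝ 2 u x) (hl : l u x ≠ 0) (V : VField) :
    ω₁ x (nabla L V (normal u L) x) =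
      horizRatio u L x * along V (fun y => p u y / l u y) x
      + p u x / l u x * along V (horizRatio u L) x
      + (L + 1) / 2 * (ω₂ x (V x) * (horizRatio u L x * tilt u x * (1 / L))
        + ω x (V x) * (horizRatio u L x * (q u x / l u x))) := by
  have dN := (contDiffAt_normal (n := 1) hu hl L).differentiableAt one_ne_zero
  have e : (fun y => ω₁ y (normal u L y)) =ᶠ[𝓝 x] fun y => horizRatio u L y * (p u y / l u y) :=
    (eventually_l_ne_zero hu hl).mono fun y hy => ω₁_normal_eq hy L
  rw [ω₁_nabla hL dN, ω₂_normal_eq hl, ω_normal_eq hL hl, along, e.fderiv_eq]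
  change along V (fun y => horizRatio u L y * (p u y / l u y)) x + _ = _
  rw [along_mul (differentiableAt_horizRatio hu hl L) (differentiableAt_p_div_l hu hl)]
  ring

theorem ω₂_nabla_normal (hL : 0 < L) (hu : ContDiffAt ℝ 2 u x) (hl : l u x ≠ 0) (V : VField) :
    ω₂ x (nabla L V (normal u L) x) =
      horizRatio u L x * along V (fun y => q u y / l u y) x
      + q u x / l u x * along V (horizRatio u L) x
      - (L - 1) / 2 * (ω₁ x (V x) * (horizRatio u L x * tilt u x * (1 / L)))
      - (L + 1) / 2 * (ω x (V x) * (horizRatio u L x * (p u x / l u x))) := by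
  have dN := (contDiffAt_normal (n := 1) hu hl L).differentiableAt one_ne_zero
  have e : (fun y => ω₂ y (normal u L y)) =ᶠ[𝓝 x] fun y => horizRatio u L y * (q u y / l u y) :=
    (eventually_l_ne_zero hu hl).mono fun y hy => ω₂_normal_eq hy L
  rw [ω₂_nabla hL dN, ω₁_normal_eq hl, ω_normal_eq hL hl, along, e.fderiv_eq]
  change along V (fun y => horizRatio u L y * (q u y / l u y)) x - _ - _ = _
  rw [along_mul (differentiableAt_horizRatio hu hl L) (differentiableAt_q_div_l hu hl)]
  ring

theorem ω_nabla_normal (hL : 0 < L) (hu : ContDiffAt ℝ 2 u x) (hl : l u x ≠ 0) (V : VField) :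
    ω x (nabla L V (normal u L) x) =
      (along V (horizRatio u L) x * tilt u x + horizRatio u L x * along V (tilt u) x) * (1 / L)
      + (1 - 1 / L) / 2 * (ω₁ x (V x) * (horizRatio u L x * (q u x / l u x)))
      - (1 + 1 / L) / 2 * (ω₂ x (V x) * (horizRatio u L x * (p u x / l u x))) := by
  have dN := (contDiffAt_normal (n := 1) hu hl L).differentiableAt one_ne_zero
  have dK := differentiableAt_horizRatio hu hl L
  have dH := differentiableAt_tilt hu hl
  have e : (fun y => ω y (normal u L y)) =ᶠ[𝓝 x]
      fun y => 1 / L * (horizRatio u L y * tilt u y) :=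
    (eventually_l_ne_zero hu hl).mono fun y hy => ω_normal_eq hL hy
  rw [ω_nabla hL dN, ω₁_normal_eq hl, ω₂_normal_eq hl, along, e.fderiv_eq]
  change along V (fun y => 1 / L * (horizRatio u L y * tilt u y)) x + _ - _ = _
  rw [along_const_mul _ (dK.fun_mul dH), along_mul dK dH]
  ring

end Surface

/-! ### The Gaussian curvature and its limit -/

section Limit

variable {u : Pt → ℝ} {L : ℝ} {x : Pt}

/-- The primed forms of the coordinates of `e₂` separate the factor `k L^{-1/2}` from a vector that
does not depend on `L`. -/
theorem ω₁_e₂' (hl : l u x ≠ 0) (L : ℝ) : ω₁ x (e₂ u L x) =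
    horizRatio u L x * (√L)⁻¹ * (tilt u x * (p u x / l u x)) := by
  have := lL_ne_zero (L := L) hl
  rw [ω₁_e₂, r_eq, horizRatio, tilt]; field_simp

theorem ω₂_e₂' (hl : l u x ≠ 0) (L : ℝ) : ω₂ x (e₂ u L x) =
    horizRatio u L x * (√L)⁻¹ * (tilt u x * (q u x / l u x)) := by
  have := lL_ne_zero (L := L) hl
  rw [ω₂_e₂, r_eq, horizRatio, tilt]; field_simp

theorem ω_e₂' (u : Pt → ℝ) (L : ℝ) (x : Pt) :
    ω x (e₂ u L x) = -(horizRatio u L x * (√L)⁻¹) := ω_e₂ u L x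

theorem along_e₂_tilt (hl : l u x ≠ 0) (L : ℝ) : along (e₂ u L) (tilt u) x =
    horizRatio u L x * (√L)⁻¹ * (tilt u x * (p u x / l u x * along X₁ (tilt u) x
      + q u x / l u x * along X₂ (tilt u) x) - along X₃ (tilt u) x) := by
  rw [along_eq, ω₁_e₂' hl, ω₂_e₂' hl, ω_e₂']; ring

theorem secondFundamentalForm_e₁_e₁ (hL : 0 < L) (hu : ContDiffAt ℝ 2 u x) (hl : l u x ≠ 0) :
    metric L x (nabla L (e₁ u) (normal u L) x) (e₁ u x) = horizRatio u L x *
      (q u x / l u x * along (e₁ u) (fun y => p u y / l u y) x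
        - p u x / l u x * along (e₁ u) (fun y => q u y / l u y) x
        - tilt u x * (p u x / l u x) * (q u x / l u x) * (1 / L)) := by
  rw [metric, ω₁_nabla_normal hL hu hl, ω₂_nabla_normal hL hu hl, ω₁_e₁, ω₂_e₁, ω_e₁]
  ring

/-- The derivative of `k = l/l_L` drops out, because it occurs multiplied by `P² + Q² - 1`. The
summand `L/2` is responsible for the divergence of `II₁₂²`. -/
theorem secondFundamentalForm_e₁_e₂ (hL : 0 < L) (hu : ContDiffAt ℝ 2 u x) (hl : l u x ≠ 0) :
    metric L x (nabla L (e₁ u) (normal u L) x) (e₂ u L x) = -(√L)⁻¹ *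
      (horizRatio u L x ^ 2 * along (e₁ u) (tilt u) x
        + (L + (p u x / l u x) ^ 2 - (q u x / l u x) ^ 2) / 2) := by
  have hAB := horizNormal_mul_along hu hl (e₁ u)
  have hLt : L * (1 / L) = 1 := by field_simp
  have hPQ := horizNormal_sq hl
  have hk := horizRatio_sq hL hl
  rw [metric, ω₁_nabla_normal hL hu hl, ω₂_nabla_normal hL hu hl, ω_nabla_normal hL hu hl,
    ω₁_e₁, ω₂_e₁, ω_e₁, ω₁_e₂' hl, ω₂_e₂' hl, ω_e₂']
  generalize along (e₁ u) (fun y => p u y / l u y) x = A at *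
  generalize along (e₁ u) (fun y => q u y / l u y) x = B at *
  generalize along (e₁ u) (horizRatio u L) x = K at *
  generalize 1 / L = t at *
  generalize horizRatio u L x = k at *
  generalize p u x / l u x = P at *
  generalize q u x / l u x = Q at *
  generalize tilt u x = h at *
  generalize along (e₁ u) (tilt u) x = H at *
  generalize (√L)⁻¹ = s at *
  linear_combination k * s * h * k * hAB + k * s * h * K * hPQ
    - s / 2 * ((L + 1) * P ^ 2 + (L - 1) * Q ^ 2) * hk - s / 2 * L * hPQ
    - k * s * (K * h + k * H - k * Q ^ 2 / 2 + k * P ^ 2 / 2) * hLt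

/-- `II₂₂ = O(1/L)`, because `e₂` itself is of size `L^{-1/2}` in the coordinates of `X₁, X₂, X₃`. -/
theorem secondFundamentalForm_e₂_e₂ (hL : 0 < L) (hu : ContDiffAt ℝ 2 u x) (hl : l u x ≠ 0) :
    metric L x (nabla L (e₂ u L) (normal u L) x) (e₂ u L x) = horizRatio u L x * (1 / L) *
      (tilt u x * (p u x / l u x) * (q u x / l u x) - horizRatio u L x ^ 2 *
        (tilt u x * (p u x / l u x * along X₁ (tilt u) x
          + q u x / l u x * along X₂ (tilt u) x) - along X₃ (tilt u) x)) := by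
  have hAB := horizNormal_mul_along hu hl (e₂ u L)
  have hLt : L * (1 / L) = 1 := by field_simp
  have hPQ := horizNormal_sq hl
  have hk := horizRatio_sq hL hl
  have hs := inv_sqrt_sq hL
  rw [metric, ω₁_nabla_normal hL hu hl, ω₂_nabla_normal hL hu hl, ω_nabla_normal hL hu hl,
    along_e₂_tilt hl, ω₁_e₂' hl, ω₂_e₂' hl, ω_e₂']
  generalize along (e₂ u L) (fun y => p u y / l u y) x = A at *
  generalize along (e₂ u L) (fun y => q u y / l u y) x = B at *
  generalize along (e₂ u L) (horizRatio u L) x = K at *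
  generalize 1 / L = t at *
  generalize horizRatio u L x = k at *
  generalize p u x / l u x = P at *
  generalize q u x / l u x = Q at *
  generalize tilt u x = h at *
  generalize along X₁ (tilt u) x = H₁ at *
  generalize along X₂ (tilt u) x = H₂ at *
  generalize along X₃ (tilt u) x = H₃ at *
  generalize (√L)⁻¹ = s at *
  linear_combination k * s * h * k * hAB + k * s * h * K * hPQ
    + k * P * Q * h * t * hk
    + (k ^ 3 * P * Q * h * (1 + h ^ 2 * t) - k ^ 3 * (h * (P * H₁ + Q * H₂) - H₃)) * hs
    - k * s * (K * h + k * (k * s * (h * (P * H₁ + Q * H₂) - H₃))) * hLt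
    + k ^ 3 * P * Q * h * s ^ 2 * hLt

/-- The Gaussian curvature as a polynomial in `t = 1/L` and `k = (l/l_L)² = (1 + h² t)⁻¹`, with the
terms of order `L` already cancelled. Here `(P, Q)` is the horizontal unit normal, `h` is `tilt`,
`β = Q e₁(P) - P e₁(Q)`, `H₁ = e₁(h)`, and `Hτ` is the derivative of `h` along
`h (P X₁ + Q X₂) - X₃`, the vector to which `e₂` is proportional. -/
noncomputable def curvaturePoly (h P Q β H₁ Hτ t k : ℝ) : ℝ :=
  -k * h ^ 2 + (k - 1) / 2 * (P ^ 2 - Q ^ 2) - k * H₁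
  + t * (k * (P ^ 2 - 3 * Q ^ 2) / 4 + (t - 2) * k * h ^ 2 / 4
    - k ^ 2 * H₁ ^ 2 - k * H₁ * (P ^ 2 - Q ^ 2) - (P ^ 2 - Q ^ 2) ^ 2 / 4
    + k * (β - h * P * Q * t) * (h * P * Q - k * Hτ))

theorem gaussCurvature_eq (hL : 0 < L) (hu : ContDiffAt ℝ 2 u x) (hl : l u x ≠ 0) :
    gaussCurvature u L x = curvaturePoly (tilt u x) (p u x / l u x) (q u x / l u x)
      (q u x / l u x * along (e₁ u) (fun y => p u y / l u y) x
        - p u x / l u x * along (e₁ u) (fun y => q u y / l u y) x)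
      (along (e₁ u) (tilt u) x)
      (tilt u x * (p u x / l u x * along X₁ (tilt u) x
          + q u x / l u x * along X₂ (tilt u) x) - along X₃ (tilt u) x)
      (1 / L) (1 + tilt u x ^ 2 * (1 / L))⁻¹ := by
  have hk := horizRatio_sq hL hl
  have hLt : L * (1 / L) = 1 := by field_simp
  have hPQ := horizNormal_sq hl
  have hs := inv_sqrt_sq hL
  rw [← eq_inv_of_mul_eq_one_left hk, gaussCurvature, ambientCurvature, neg_metric_curvatureTensor hL,
    secondFundamentalForm, Matrix.det_fin_two_of, metric_nabla_normal_symm hL hu hl,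
    secondFundamentalForm_e₁_e₁ hL hu hl, secondFundamentalForm_e₁_e₂ hL hu hl,
    secondFundamentalForm_e₂_e₂ hL hu hl, ω₁_e₁, ω₂_e₁, ω_e₁, ω₁_e₂' hl, ω₂_e₂' hl, ω_e₂',
    curvaturePoly, show (3 : ℝ) / L = 3 * (1 / L) by ring]
  generalize 1 / L = t at *
  generalize horizRatio u L x = k at *
  generalize p u x / l u x = P at *
  generalize q u x / l u x = Q at *
  generalize tilt u x = h at *
  generalize along (e₁ u) (tilt u) x = H at *
  generalize (√L)⁻¹ = s at *
  linear_combination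
    ((L + 2 + t) / 4 * L * P ^ 2 * k ^ 2 + (L - 2 - 3 * t) / 4 * L * Q ^ 2 * k ^ 2
      + (-3 * L - 2 + t) / 4 * k ^ 2 * h ^ 2 * (P ^ 2 + Q ^ 2) ^ 2
      - (k ^ 2 * H + (L + P ^ 2 - Q ^ 2) / 2) ^ 2) * hs
    + ((L + 2 + t) / 4 * k ^ 2 * P ^ 2 + (L - 2 - 3 * t) / 4 * k ^ 2 * Q ^ 2
      - 3 / 4 * k ^ 2 * h ^ 2 * (P ^ 2 + Q ^ 2) ^ 2 - (k ^ 2 * H + L / 4 + (P ^ 2 - Q ^ 2) / 2)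
      - k ^ 2 * h ^ 2 / 4) * hLt
    + ((-3 / 4 * k ^ 2 * h ^ 2 + (-2 + t) / 4 * k ^ 2 * t * h ^ 2) * (P ^ 2 + Q ^ 2 + 1)
      + L / 4 * k ^ 2) * hPQ
    -- `L k² + k² h² = L` removes the terms of order `L`.
    + L / 4 * hk

theorem limitCurvature_eq (u : Pt → ℝ) (x : Pt) :
    limitCurvature u x = -tilt u x ^ 2 - along (e₁ u) (tilt u) x := by
  have e : (fun y => along X₃ u y / l u y) = tilt u := rfl
  rw [limitCurvature, e, along_eq (e₁ u), tilt, horizGrad]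
  simp only [metric, ω₁_add, ω₂_add, ω_add, ω₁_smul, ω₂_smul, ω_smul, ω₁_X₁, ω₂_X₁, ω_X₁, ω₁_X₂,
    ω₂_X₂, ω_X₂, ω_e₁]
  ring

theorem tendsto_gaussCurvature (hu : ContDiffAt ℝ 2 u x) (hl : l u x ≠ 0) :
    Tendsto (fun L : ℝ => gaussCurvature u L x) atTop (𝓝 (limitCurvature u x)) := by
  refine Tendsto.congr' ((eventually_gt_atTop 0).mono fun L hL =>
    (gaussCurvature_eq hL hu hl).symm) ?_
  have ht : Tendsto (fun L : ℝ => 1 / L) atTop (𝓝 0) := by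
    simpa using tendsto_inv_atTop_zero (𝕜 := ℝ)
  rw [limitCurvature_eq]
  set h := tilt u x
  have hk : ContinuousAt (fun t : ℝ => (1 + h ^ 2 * t)⁻¹) 0 :=
    ContinuousAt.inv₀ (by fun_prop) (by simp)
  have hc : ∀ P Q β H₁ Hτ, Tendsto
      (fun L : ℝ => curvaturePoly h P Q β H₁ Hτ (1 / L) (1 + h ^ 2 * (1 / L))⁻¹) atTop
      (𝓝 (-h ^ 2 - H₁)) := by
    intro P Q β H₁ Hτ
    have hcont : ContinuousAt (fun t => curvaturePoly h P Q β H₁ Hτ t (1 + h ^ 2 * t)⁻¹) 0 := by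
      unfold curvaturePoly
      fun_prop
    have h0 : curvaturePoly h P Q β H₁ Hτ 0 (1 + h ^ 2 * 0)⁻¹ = -h ^ 2 - H₁ := by
      rw [curvaturePoly, mul_zero, add_zero, inv_one]
      ring
    simpa only [h0, Function.comp_def] using hcont.tendsto.comp ht
  exact hc _ _ _ _ _

end Limit

end E11

theorem proposition6p6 (u : E11.Pt → ℝ) (hu : ContDiff ℝ 2 u) (x : E11.Pt)
    (hx : x ∈ E11.surface u) (hchar : x ∉ E11.characteristicSet u) :
    Tendsto (fun L : ℝ => E11.gaussCurvature u L x) atTop (𝓝 (E11.limitCurvature u x)) ∧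
    (ContDiffAt ℝ 3 u x →
      (∀ L : ℝ, 0 < L → E11.intrinsicGaussCurvature u L x = E11.gaussCurvature u L x) ∧
      Tendsto (fun L : ℝ => E11.intrinsicGaussCurvature u L x) atTop
        (𝓝 (E11.limitCurvature u x))) := by
  have hl := E11.l_ne_zero_of_notMem hx hchar
  have ht := E11.tendsto_gaussCurvature hu.contDiffAt hl
  refine ⟨ht, fun hu3 => ?_⟩
  have he : ∀ L : ℝ, 0 < L → E11.intrinsicGaussCurvature u L x = E11.gaussCurvature u L x :=
    fun L hL => E11.intrinsicGaussCurvature_eq hL hu3 hl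
  exact ⟨he, ht.congr' ((eventually_gt_atTop 0).mono fun L hL => (he L hL).symm)⟩
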